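/- Let $G$ be a finite group. A tuple $T=(g_1,\dots,g_r)$ of non-trivial elements of $G$ is a spherical system of generators of $G$ if $\langle g_1,\dots,g_r\rangle=G$ and $g_1g_2\cdots g_r=1$. Put $\Sigma(T)=\bigcup_{g\in G}\bigcup_{i=1}^{r}\langle g_i\rangle^{g}$, the union of all conjugates of the cyclic subgroups generated by the entries of $T$. A ramification structure of size $(r_1,r_2)$ for $G$ is a pair $(T_1,T_2)$ of spherical systems of generators of $G$, of lengths $r_1$ and $r_2$, such that $\Sigma(T_1)\cap\Sigma(T_2)=\{1\}$. Proposition. Let $p\ge 5$ be a prime. Then there exists a finite $p$-group $G$, of exponent $p^e$ with $e\ge 1$, such that: (i) $|\{g^{p^{e-1}} \mid g\in G\}|=p$; (ii) $G$ admits a ramification structure of size $(r_1,r_2)$ for all integers $r_1,r_2\ge 3$. -/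

import Mathlib

/-- A tuple `T = (g₁, …, g_r)` of non-trivial elements of `G` is a spherical system of generators
if it generates `G` and `g₁ g₂ ⋯ g_r = 1` (product taken in this order). -/
structure IsSphericalSystem {G : Type*} [Group G] {r : ℕ} (T : Fin r → G) : Prop where
  ne_one : ∀ i, T i ≠ 1
  closure_eq_top : Subgroup.closure (Set.range T) = ⊤
  prod_eq_one : (List.ofFn T).prod = 1

/-- `Σ(T)`: the union of all conjugates `g⁻¹ ⟨gᵢ⟩ g` of the cyclic subgroups generated by the
entries of the tuple `T`. -/
def sphericalSigma {G : Type*} [Group G] {r : ℕ} (T : Fin r → G) : Set G :=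
  ⋃ (g : G) (i : Fin r),
    (((Subgroup.zpowers (T i)).map (MulAut.conj g⁻¹).toMonoidHom : Subgroup G) : Set G)

/-- `(T₁, T₂)` is an (unmixed) ramification structure of size `(r₁, r₂)` for `G`: both tuples are
spherical systems of generators, and they are disjoint, i.e. `Σ(T₁) ∩ Σ(T₂) = 1`. -/
structure IsRamificationStructure {G : Type*} [Group G] {r₁ r₂ : ℕ}
    (T₁ : Fin r₁ → G) (T₂ : Fin r₂ → G) : Prop where
  left : IsSphericalSystem T₁
  right : IsSphericalSystem T₂
  disjoint : sphericalSigma T₁ ∩ sphericalSigma T₂ = {1}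

/-- `S(G)`: the set of all sizes `(r₁, r₂)` of ramification structures of `G`. -/
def ramificationSizes (G : Type*) [Group G] : Set (ℕ × ℕ) :=
  {r | ∃ (T₁ : Fin r.1 → G) (T₂ : Fin r.2 → G), IsRamificationStructure T₁ T₂}

/-! Take unitriangular matrices of size p + 1 over `ZMod p`. By Frobenius, A ^ p = 1 + (A - 1) ^ p,
and only the top-right corner of (A - 1) ^ p can be nonzero: it is the product of the superdiagonal
(`IsUnitriangular.pow_prime`). So p-th powers lie on a line of p elements. Restrict the
superdiagonal to t, s, s - t, s, s, …. The product vanishes exactly for s = 0, t = 0 or s = t, the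
classes of powers of X, Y and XY. These three elements have order p, while X²Y has order p², and the
p-th powers of its powers fill the line. For the ramification structures, T₁ uses x, y, xy and T₂
uses xy⁻¹, xy² and their product. Modulo p these six elements have directions (1,0), (0,1), (1,1)
and (1,-1), (1,2), (2,1). A common element of the Σ's is conjugate to t ^ k with t among x, y, xy;
comparing directions gives p ∣ k, hence t ^ k = 1. The orders of the entries of T₂ are irrelevant.
-/

/-! ### Ramification structures from two generators. -/

section RamificationCriterion

variable {G : Type*} [Group G]

/-- Any two elements of a group can be completed to a list of prescribed length `n ≥ 3` with
product `1`, made of generators of the subgroups `⟨x⟩`, `⟨y⟩` and `⟨xy⟩`. -/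
theorem exists_list_prod_eq_one (x y : G) : ∀ n : ℕ, ∃ l : List G, l.length = n + 3 ∧
    l.prod = 1 ∧ x ∈ l ∧ y ∈ l ∧
      ∀ t ∈ l, ∃ t₀, (t₀ = x ∨ t₀ = y ∨ t₀ = x * y) ∧ (t = t₀ ∨ t = t₀⁻¹)
  | 0 => ⟨[x, y, (x * y)⁻¹], rfl, by simp, by simp, by simp, by
      simp only [List.mem_cons, List.not_mem_nil, or_false]
      rintro t (rfl | rfl | rfl)
      exacts [⟨_, .inl rfl, .inl rfl⟩, ⟨_, .inr (.inl rfl), .inl rfl⟩,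
        ⟨_, .inr (.inr rfl), .inr rfl⟩]⟩
  | 1 => ⟨[x, y, y⁻¹, x⁻¹], rfl, by simp, by simp, by simp, by
      simp only [List.mem_cons, List.not_mem_nil, or_false]
      rintro t (rfl | rfl | rfl | rfl)
      exacts [⟨_, .inl rfl, .inl rfl⟩, ⟨_, .inr (.inl rfl), .inl rfl⟩,
        ⟨_, .inr (.inl rfl), .inr rfl⟩, ⟨_, .inl rfl, .inr rfl⟩]⟩
  | n + 2 => by
      obtain ⟨l, hl, hp, hx, hy, h⟩ := exists_list_prod_eq_one x y n
      refine ⟨x :: x⁻¹ :: l, by simp [hl], by simp [hp], by simp, by simp [hy], ?_⟩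
      simp only [List.mem_cons]
      rintro t (rfl | rfl | ht)
      exacts [⟨_, .inl rfl, .inl rfl⟩, ⟨_, .inl rfl, .inr rfl⟩, h t ht]

/-- Two generators `x`, `y` with `x`, `y`, `xy` non-trivial give spherical systems of generators
of every length at least `3`. -/
theorem exists_isSphericalSystem {x y : G} (hxy : Subgroup.closure {x, y} = ⊤) (hx : x ≠ 1)
    (hy : y ≠ 1) (hxy1 : x * y ≠ 1) {r : ℕ} (hr : 3 ≤ r) :
    ∃ T : Fin r → G, IsSphericalSystem T ∧
      ∀ i, ∃ t₀, (t₀ = x ∨ t₀ = y ∨ t₀ = x * y) ∧ (T i = t₀ ∨ T i = t₀⁻¹) := by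
  obtain ⟨n, rfl⟩ := Nat.exists_eq_add_of_le' hr
  obtain ⟨l, hl, hp, hxl, hyl, h⟩ := exists_list_prod_eq_one x y n
  rw [← hl]
  refine ⟨l.get, ⟨fun i => ?_, ?_, by rw [List.ofFn_get, hp]⟩, fun i => h _ (l.get_mem i)⟩
  · obtain ⟨t₀, rfl | rfl | rfl, h | h⟩ := h _ (l.get_mem i) <;> rw [h] <;>
      simpa only [ne_eq, inv_eq_one]
  · rw [eq_top_iff, ← hxy]
    apply Subgroup.closure_mono
    rintro z (rfl | rfl)
    exacts [List.mem_iff_get.1 hxl, List.mem_iff_get.1 hyl]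

/-- An element of `Σ(T)` is a conjugate of a power of an entry of `T`. -/
theorem exists_zpow_of_mem_sphericalSigma {r : ℕ} {T : Fin r → G} {z : G}
    (hz : z ∈ sphericalSigma T) : ∃ (i : Fin r) (k : ℤ) (g : G), z = g⁻¹ * T i ^ k * g := by
  simp only [sphericalSigma, Set.mem_iUnion] at hz
  obtain ⟨g, i, w, ⟨k, rfl⟩, rfl⟩ := hz
  exact ⟨i, k, g, by simp⟩

theorem one_mem_sphericalSigma {r : ℕ} (hr : 0 < r) (T : Fin r → G) : 1 ∈ sphericalSigma T := by
  simp only [sphericalSigma, Set.mem_iUnion]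
  exact ⟨1, ⟨0, hr⟩, Subgroup.one_mem _⟩

/-- A group generated by two elements `x`, `y` such that `x`, `y`, `xy` have order dividing a prime
`p ≥ 5` and which are independent in the abelianization modulo `p` has ramification structures of
all sizes. -/
theorem mem_ramificationSizes_of_pow_eq_one {p : ℕ} (hp : p.Prime) (hp5 : 5 ≤ p) {x y : G}
    (hxy : Subgroup.closure {x, y} = ⊤) (hx : x ^ p = 1) (hy : y ^ p = 1) (hxyp : (x * y) ^ p = 1)
    (σ τ : G →* Multiplicative (ZMod p)) (hσx : σ x = .ofAdd 1) (hσy : σ y = 1) (hτx : τ x = 1)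
    (hτy : τ y = .ofAdd 1) {r₁ r₂ : ℕ} (hr₁ : 3 ≤ r₁) (hr₂ : 3 ≤ r₂) :
    (r₁, r₂) ∈ ramificationSizes G := by
  have : Fact p.Prime := ⟨hp⟩
  have h2 : (2 : ZMod p) ≠ 0 := by
    intro h
    have := Nat.le_of_dvd (by norm_num) ((ZMod.natCast_eq_zero_iff 2 p).1 (by exact_mod_cast h))
    omega
  have ne_one_of (g : G) (h : (σ g).toAdd ≠ 0 ∨ (τ g).toAdd ≠ 0) : g ≠ 1 := by
    rintro rfl
    simp at h
  have hgen : Subgroup.closure {x * y⁻¹, x * y ^ 2} = ⊤ := by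
    set H := Subgroup.closure {x * y⁻¹, x * y ^ 2} with hH
    have hu : x * y⁻¹ ∈ H := Subgroup.subset_closure (by simp)
    have hv : x * y ^ 2 ∈ H := Subgroup.subset_closure (by simp)
    have h3 : y ^ 3 ∈ H := by
      have := H.mul_mem (H.inv_mem hu) hv
      rwa [show (x * y⁻¹)⁻¹ * (x * y ^ 2) = y ^ 3 by group] at this
    have hyH : y ∈ H := by
      -- Here p ≠ 3 is needed: 3 is the determinant of (1,-1), (1,2).
      have hc : Nat.Coprime 3 p := (Nat.coprime_primes Nat.prime_three hp).2 (by omega)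
      have hord : (orderOf y).Coprime 3 :=
        (hc.coprime_dvd_right (orderOf_dvd_of_pow_eq_one hy)).symm
      obtain ⟨m, hm⟩ := exists_pow_eq_self_of_coprime hord.symm
      rw [← hm]
      exact H.pow_mem h3 m
    rw [eq_top_iff, ← hxy, Subgroup.closure_le]
    rintro z (rfl | rfl)
    · simpa using H.mul_mem hu hyH
    · exact hyH
  obtain ⟨T₁, hT₁, h₁⟩ := exists_isSphericalSystem hxy (ne_one_of x (by simp [hσx]))
    (ne_one_of y (by simp [hτy])) (ne_one_of _ (by simp [hσx, hσy])) hr₁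
  obtain ⟨T₂, hT₂, h₂⟩ := exists_isSphericalSystem hgen (ne_one_of _ (by simp [hσx, hσy]))
    (ne_one_of _ (by simp [hσx, hσy]))
    (ne_one_of _ (.inl (by simpa [hσx, hσy, one_add_one_eq_two] using h2))) hr₂
  have hpow {t₀ t : G} (h : t = t₀ ∨ t = t₀⁻¹) (k : ℤ) : ∃ m : ℤ, t ^ k = t₀ ^ m := by
    rcases h with rfl | rfl
    exacts [⟨k, rfl⟩, ⟨-k, by simp⟩]
  refine ⟨T₁, T₂, hT₁, hT₂, Set.Subset.antisymm ?_ ?_⟩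
  · rintro z ⟨hz₁, hz₂⟩
    obtain ⟨i, k, g, hk⟩ := exists_zpow_of_mem_sphericalSigma hz₁
    obtain ⟨j, m, h, hm⟩ := exists_zpow_of_mem_sphericalSigma hz₂
    obtain ⟨t, ht, hti⟩ := h₁ i
    obtain ⟨w, hw, hwj⟩ := h₂ j
    obtain ⟨k, hk'⟩ := hpow hti k
    obtain ⟨m, hm'⟩ := hpow hwj m
    rw [hk'] at hk
    rw [hm'] at hm
    have key (ρ : G →* Multiplicative (ZMod p)) :
        (k : ZMod p) * (ρ t).toAdd = m * (ρ w).toAdd := by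
      have := congrArg (fun g => (ρ g).toAdd) (hk.symm.trans hm)
      simpa [toAdd_zpow] using this
    have hσ := key σ
    have hτ := key τ
    have htp : t ^ p = 1 := by rcases ht with rfl | rfl | rfl <;> assumption
    have hk0 : (k : ZMod p) = 0 := by
      -- Each of the nine pairs of directions has determinant ±1 or ±2, so eliminating `m` always
      -- gives 2k = 0.
      apply (mul_eq_zero_iff_left h2).1
      rcases ht with rfl | rfl | rfl <;> rcases hw with rfl | rfl | rfl <;>
        simp [hσx, hσy, hτx, hτy] at hσ hτ <;> grind
    obtain ⟨c, rfl⟩ := (ZMod.intCast_zmod_eq_zero_iff_dvd k p).1 hk0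
    rw [hk, zpow_mul, zpow_natCast, htp]
    simp
  · rintro z rfl
    exact ⟨one_mem_sphericalSigma (by omega) _, one_mem_sphericalSigma (by omega) _⟩

end RamificationCriterion

/-! ### Powers of unitriangular matrices. -/

section Unitriangular

variable {R : Type*} [CommRing R] {n : ℕ}

/-- `N` is strictly upper triangular with superdiagonal `c`. -/
structure IsStrictUpper (c : ℕ → R) (N : Matrix (Fin n) (Fin n) R) : Prop where
  eq_zero : ∀ i j, j.val ≤ i.val → N i j = 0
  superdiag : ∀ i j, j.val = i.val + 1 → N i j = c i

/-- `A` is upper unitriangular with superdiagonal `c`. -/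
def IsUnitriangular (c : ℕ → R) (A : Matrix (Fin n) (Fin n) R) : Prop :=
  IsStrictUpper c (A - 1)

theorem IsStrictUpper.pow_eq_zero {c : ℕ → R} {N : Matrix (Fin n) (Fin n) R}
    (hN : IsStrictUpper c N) (k : ℕ) : ∀ i j : Fin n, j.val < i.val + k → (N ^ k) i j = 0 := by
  induction k with
  | zero =>
    intro i j h
    rw [pow_zero, Matrix.one_apply_ne]
    rintro rfl
    omega
  | succ k ih =>
    intro i j h
    rw [pow_succ, Matrix.mul_apply]
    refine Finset.sum_eq_zero fun l _ => ?_
    by_cases hl : l.val < i.val + k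
    · rw [ih i l hl, zero_mul]
    · rw [hN.eq_zero l j (by omega), mul_zero]

theorem IsStrictUpper.pow_apply {c : ℕ → R} {N : Matrix (Fin n) (Fin n) R}
    (hN : IsStrictUpper c N) (k : ℕ) : ∀ i j : Fin n, j.val = i.val + k →
      (N ^ k) i j = ∏ l ∈ Finset.range k, c (i + l) := by
  induction k with
  | zero =>
    intro i j h
    rw [show j = i from Fin.ext h]
    simp
  | succ k ih =>
    intro i j h
    rw [pow_succ, Matrix.mul_apply, Finset.prod_range_succ,
      Finset.sum_eq_single (⟨i + k, by omega⟩ : Fin n)]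
    · rw [ih i _ rfl, hN.superdiag _ _ (by simp only; omega)]
    · intro l _ hl
      have hl' : l.val ≠ i.val + k := fun h => hl (Fin.ext h)
      by_cases hlk : l.val < i.val + k
      · rw [hN.pow_eq_zero k i l hlk, zero_mul]
      · rw [hN.eq_zero l j (by omega), mul_zero]
    · simp

theorem IsStrictUpper.add {c d : ℕ → R} {M N : Matrix (Fin n) (Fin n) R}
    (hM : IsStrictUpper c M) (hN : IsStrictUpper d N) : IsStrictUpper (c + d) (M + N) where
  eq_zero i j h := by simp [hM.eq_zero i j h, hN.eq_zero i j h]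
  superdiag i j h := by simp [hM.superdiag i j h, hN.superdiag i j h]

theorem IsStrictUpper.mul {c d : ℕ → R} {M N : Matrix (Fin n) (Fin n) R}
    (hM : IsStrictUpper c M) (hN : IsStrictUpper d N) : IsStrictUpper 0 (M * N) := by
  have h (i j : Fin n) (h : j.val ≤ i.val + 1) : (M * N) i j = 0 := by
    rw [Matrix.mul_apply]
    refine Finset.sum_eq_zero fun l _ => ?_
    by_cases hl : l.val ≤ i.val
    · rw [hM.eq_zero i l hl, zero_mul]
    · rw [hN.eq_zero l j (by omega), mul_zero]
  exact ⟨fun i j hij => h i j (by omega), fun i j hij => h i j hij.le⟩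

theorem IsUnitriangular.one : IsUnitriangular 0 (1 : Matrix (Fin n) (Fin n) R) := by
  constructor <;> simp

theorem IsUnitriangular.mul {c d : ℕ → R} {A B : Matrix (Fin n) (Fin n) R}
    (hA : IsUnitriangular c A) (hB : IsUnitriangular d B) : IsUnitriangular (c + d) (A * B) := by
  have := (IsStrictUpper.add hA hB).add (IsStrictUpper.mul hA hB)
  rw [add_zero] at this
  rw [IsUnitriangular]
  convert this using 1
  -- AB - 1 = (A - 1) + (B - 1) + (A - 1)(B - 1).
  noncomm_ring

theorem IsUnitriangular.pow {c : ℕ → R} {A : Matrix (Fin n) (Fin n) R}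
    (hA : IsUnitriangular c A) (k : ℕ) : IsUnitriangular (k • c) (A ^ k) := by
  induction k with
  | zero => simpa using IsUnitriangular.one
  | succ k ih => simpa only [pow_succ, succ_nsmul] using ih.mul hA

theorem IsUnitriangular.apply {c : ℕ → R} {A : Matrix (Fin n) (Fin n) R}
    (hA : IsUnitriangular c A) {i j : Fin n} (h : j.val = i.val + 1) : A i j = c i := by
  have hij : i ≠ j := by
    rintro rfl
    omega
  simpa [Matrix.one_apply_ne hij] using hA.superdiag i j h

theorem exists_isUnitriangular (c : ℕ → R) :
    ∃ A : Matrix (Fin n) (Fin n) R, IsUnitriangular c A := by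
  refine ⟨1 + Matrix.of fun i j : Fin n => if j.val = i.val + 1 then c i else 0, ?_, ?_⟩
  · intro i j h
    simp only [add_sub_cancel_left, Matrix.of_apply]
    exact if_neg (by omega)
  · intro i j h
    simp only [add_sub_cancel_left, Matrix.of_apply]
    exact if_pos h

theorem Matrix.pow_prime_pow_eq_one_add {p : ℕ} [Fact p.Prime] [CharP R p]
    (A : Matrix (Fin (n + 1)) (Fin (n + 1)) R) (k : ℕ) :
    A ^ p ^ k = 1 + (A - 1) ^ p ^ k := by
  conv_lhs => rw [← add_sub_cancel 1 A]
  rw [add_pow_char_pow_of_commute _ _ (Commute.one_left _), one_pow]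

theorem IsUnitriangular.pow_prime_sq {p : ℕ} [Fact p.Prime] [CharP R p] {c : ℕ → R}
    {A : Matrix (Fin (p + 1)) (Fin (p + 1)) R} (hA : IsUnitriangular c A) : A ^ p ^ 2 = 1 := by
  rw [A.pow_prime_pow_eq_one_add, add_eq_left]
  ext i j
  have := (Fact.out : p.Prime).two_le
  rw [IsStrictUpper.pow_eq_zero hA, Matrix.zero_apply]
  have := j.isLt
  nlinarith

/-- The size p + 1 leaves exactly one entry at distance p above the diagonal. -/
theorem IsUnitriangular.pow_prime {p : ℕ} [Fact p.Prime] [CharP R p] {c : ℕ → R}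
    {A : Matrix (Fin (p + 1)) (Fin (p + 1)) R} (hA : IsUnitriangular c A) :
    A ^ p = 1 + Matrix.single 0 (Fin.last p) (∏ l ∈ Finset.range p, c l) := by
  have h := A.pow_prime_pow_eq_one_add (p := p) 1
  simp only [pow_one] at h
  rw [h, add_right_inj]
  ext i j
  rcases lt_or_ge j.val (i.val + p) with h | h
  · rw [IsStrictUpper.pow_eq_zero hA _ _ _ h, Matrix.single_apply_of_ne]
    rintro ⟨rfl, rfl⟩
    simp at h
  · have hi : i = 0 := Fin.ext (by simp only [Fin.val_zero]; omega)
    have hj : j = Fin.last p := Fin.ext (by simp only [Fin.val_last]; omega)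
    subst hi hj
    rw [IsStrictUpper.pow_apply hA _ _ _ (by simp), Matrix.single_apply_same]
    simp

end Unitriangular

/-! ### The pencil of superdiagonals and its group. -/

section Construction

variable {R : Type*} [CommRing R]

/-- A two-parameter linear family of superdiagonals: `t, s, s - t, s, s, …`. -/
def pencil (s t : R) : ℕ → R
  | 0 => t
  | 1 => s
  | 2 => s - t
  | _ => s

theorem pencil_add (s t s' t' : R) : pencil s t + pencil s' t' = pencil (s + s') (t + t') := by
  funext i
  match i with
  | 0 | 1 | _ + 3 => rfl
  | 2 => simp only [pencil, Pi.add_apply]; ring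

theorem prod_pencil_eq_zero {s t : R} {n : ℕ} (hn : 3 ≤ n) (h : s = 0 ∨ t = 0 ∨ s = t) :
    ∏ l ∈ Finset.range n, pencil s t l = 0 := by
  rcases h with h | h | h
  · exact Finset.prod_eq_zero (i := 1) (by simp; omega) h
  · exact Finset.prod_eq_zero (i := 0) (by simp; omega) h
  · exact Finset.prod_eq_zero (i := 2) (by simp; omega) (sub_eq_zero.2 h)

theorem prod_pencil_two_one_ne_zero [IsDomain R] (h2 : (2 : R) ≠ 0) (n : ℕ) :
    ∏ l ∈ Finset.range n, pencil (2 : R) 1 l ≠ 0 := by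
  refine Finset.prod_ne_zero_iff.2 fun l _ => ?_
  match l with
  | 0 => exact one_ne_zero
  | 1 | _ + 3 => exact h2
  | 2 =>
    rw [pencil, show (2 : R) - 1 = 1 by ring]
    exact one_ne_zero

variable (p : ℕ) [Fact p.Prime]

/-- The group of `(p + 1) × (p + 1)` unitriangular matrices over `ZMod p` whose superdiagonal
lies in the pencil. -/
def pencilSubgroup : Subgroup (Matrix (Fin (p + 1)) (Fin (p + 1)) (ZMod p))ˣ where
  carrier := {A | ∃ s t, IsUnitriangular (pencil s t) A.val}
  mul_mem' := by
    rintro A B ⟨s, t, hA⟩ ⟨s', t', hB⟩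
    exact ⟨s + s', t + t', by simpa only [Units.val_mul, pencil_add] using hA.mul hB⟩
  one_mem' := ⟨0, 0, by
    rw [Units.val_one]
    convert IsUnitriangular.one using 1
    funext i
    match i with
    | 0 | 1 | _ + 3 => rfl
    | 2 => simp [pencil]⟩
  inv_mem' := by
    rintro A ⟨s, t, hA⟩
    have hA1 : A ^ p ^ 2 = 1 := Units.ext (by simpa using hA.pow_prime_sq)
    have hpos : p ^ 2 ≠ 0 := pow_ne_zero _ (Fact.out : p.Prime).ne_zero
    -- As a positive power, the inverse is covered by `IsUnitriangular.pow`.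
    have hinv : A⁻¹ = A ^ (p ^ 2 - 1) :=
      inv_eq_of_mul_eq_one_right (by rw [mul_pow_sub_one hpos, hA1])
    refine ⟨(p ^ 2 - 1) • s, (p ^ 2 - 1) • t, ?_⟩
    rw [hinv, Units.val_pow_eq_pow_val]
    convert hA.pow (p ^ 2 - 1) using 1
    funext i
    match i with
    | 0 | 1 | _ + 3 => rfl
    | 2 => simp only [pencil, Pi.smul_apply, smul_sub]

variable {p}

theorem exists_mem_pencilSubgroup (s t : ZMod p) :
    ∃ A ∈ pencilSubgroup p, IsUnitriangular (pencil s t) A.val := by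
  obtain ⟨A, hA⟩ := exists_isUnitriangular (n := p + 1) (pencil s t)
  have hpos : p ^ 2 ≠ 0 := pow_ne_zero _ (Fact.out : p.Prime).ne_zero
  exact ⟨Units.ofPowEqOne A _ hA.pow_prime_sq hpos, ⟨s, t, hA⟩, hA⟩

variable (p) in
/-- Reading off an entry just above the diagonal, as a homomorphism. -/
def superdiagHom (i : ℕ) (hi : i < p) : pencilSubgroup p →* Multiplicative (ZMod p) :=
  MonoidHom.mk' (fun A => .ofAdd (A.1.val ⟨i, by omega⟩ ⟨i + 1, by omega⟩)) (by
    rintro ⟨A, s, t, hA⟩ ⟨B, s', t', hB⟩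
    rw [← ofAdd_add]
    congr 1
    have h := hA.mul hB
    exact (h.apply rfl).trans (congrArg₂ _ (hA.apply rfl) (hB.apply rfl)).symm)

theorem superdiagHom_apply {i : ℕ} (hi : i < p) {A : pencilSubgroup p} {c : ℕ → ZMod p}
    (hA : IsUnitriangular c A.1.val) : superdiagHom p i hi A = .ofAdd (c i) :=
  congrArg Multiplicative.ofAdd (hA.apply rfl)

end Construction

/-! ### The group generated by X and Y. -/

theorem mainTheorem7 (p : ℕ) (hp : p.Prime) (hp5 : 5 ≤ p) :
    ∃ (G : Type) (_ : Group G) (_ : Finite G), IsPGroup p G ∧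
      (∃ e : ℕ, 1 ≤ e ∧ Monoid.exponent G = p ^ e ∧
        {x : G | ∃ g : G, g ^ p ^ (e - 1) = x}.ncard = p) ∧
      ∀ r₁ r₂ : ℕ, 3 ≤ r₁ → 3 ≤ r₂ → (r₁, r₂) ∈ ramificationSizes G := by
  have : Fact p.Prime := ⟨hp⟩
  have h2 : (2 : ZMod p) ≠ 0 := by
    intro h
    have := Nat.le_of_dvd (by norm_num) ((ZMod.natCast_eq_zero_iff 2 p).1 (by exact_mod_cast h))
    omega
  obtain ⟨x, hxK, hx⟩ := exists_mem_pencilSubgroup (p := p) 1 0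
  obtain ⟨y, hyK, hy⟩ := exists_mem_pencilSubgroup (p := p) 0 1
  let H : Subgroup (pencilSubgroup p) := Subgroup.closure {⟨x, hxK⟩, ⟨y, hyK⟩}
  let X : H := ⟨⟨x, hxK⟩, Subgroup.subset_closure (by simp)⟩
  let Y : H := ⟨⟨y, hyK⟩, Subgroup.subset_closure (by simp)⟩
  let v : H → Matrix (Fin (p + 1)) (Fin (p + 1)) (ZMod p) := fun g => g.1.1.val
  have hv : Function.Injective v := fun g h e => Subtype.ext (Subtype.ext (Units.ext e))
  have hvpow (g : H) (k : ℕ) : v (g ^ k) = v g ^ k := by simp [v]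
  have hv1 : v 1 = 1 := rfl
  have hXY : IsUnitriangular (pencil 1 1) (v (X * Y)) := by
    have := hx.mul hy
    rwa [pencil_add, add_zero, zero_add] at this
  have hg0 : IsUnitriangular (pencil 2 1) (v (X * (X * Y))) := by
    have := hx.mul hXY
    rwa [pencil_add, one_add_one_eq_two, zero_add] at this
  have hpow1 {g : H} {s t : ZMod p} (hg : IsUnitriangular (pencil s t) (v g))
      (h : s = 0 ∨ t = 0 ∨ s = t) : g ^ p = 1 := by
    apply hv
    rw [hvpow, hg.pow_prime, prod_pencil_eq_zero (by omega) h, hv1]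
    simp
  have hsq (g : H) : g ^ p ^ 2 = 1 := by
    obtain ⟨s, t, hg⟩ := g.1.2
    exact hv (by rw [hvpow, hv1]; exact hg.pow_prime_sq)
  have h0last : (0 : Fin (p + 1)) ≠ Fin.last p := by
    intro h
    have := congrArg Fin.val h
    simp at this
    omega
  have hg0p : (X * (X * Y)) ^ p ≠ 1 := by
    intro h
    have h' := congrFun (congrFun (congrArg v h) 0) (Fin.last p)
    rw [hvpow, hg0.pow_prime, hv1, Matrix.add_apply, Matrix.single_apply_same, add_eq_left] at h'
    exact prod_pencil_two_one_ne_zero h2 p h'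
  refine ⟨H, inferInstance, inferInstance, fun g => ⟨2, hsq g⟩, ⟨2, by norm_num, ?_, ?_⟩, ?_⟩
  · obtain ⟨k, hk, he⟩ := (Nat.dvd_prime_pow hp).1 (Monoid.exponent_dvd_of_forall_pow_eq_one hsq)
    rw [he]
    rcases hk.eq_or_lt with rfl | hk
    · rfl
    · refine absurd ?_ hg0p
      rw [← Monoid.exponent_dvd_iff_forall_pow_eq_one.1 _ (X * (X * Y))]
      rw [he]
      exact (pow_dvd_pow p (Nat.lt_succ_iff.1 hk)).trans (by simp)
  · rw [show 2 - 1 = 1 from rfl, pow_one]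
    set S : Set H := {x | ∃ g : H, g ^ p = x}
    let f : H → ZMod p := fun g => v g 0 (Fin.last p)
    have hf {g : H} {c : ℕ → ZMod p} (hg : IsUnitriangular c (v g)) :
        f (g ^ p) = ∏ l ∈ Finset.range p, c l := by
      simp only [f]
      rw [hvpow, hg.pow_prime, Matrix.add_apply, Matrix.single_apply_same,
        Matrix.one_apply_ne h0last, zero_add]
    have hinj : Set.InjOn f S := by
      rintro _ ⟨g, rfl⟩ _ ⟨h, rfl⟩ e
      obtain ⟨s, t, hg⟩ := g.1.2
      obtain ⟨s', t', hh⟩ := h.1.2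
      rw [hf hg, hf hh] at e
      apply hv
      rw [hvpow, hvpow]
      exact hg.pow_prime.trans (e ▸ hh.pow_prime.symm)
    have himg : f '' S = Set.univ := by
      refine Set.eq_univ_of_forall fun d => ?_
      set d₀ := ∏ l ∈ Finset.range p, pencil (2 : ZMod p) 1 l
      have hd₀ : d₀ ≠ 0 := prod_pencil_two_one_ne_zero h2 p
      -- A k-th power scales the superdiagonal by k, hence its product by k ^ p = k.
      refine ⟨_, ⟨(X * (X * Y)) ^ (d / d₀).val, rfl⟩, ?_⟩
      have := hg0.pow (d / d₀).val
      rw [← hvpow] at this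
      rw [hf this]
      simp only [Pi.smul_apply, nsmul_eq_mul, Finset.prod_mul_distrib, Finset.prod_const,
        Finset.card_range, ZMod.natCast_val, ZMod.cast_id', id, ZMod.pow_card]
      exact div_mul_cancel₀ d hd₀
    rw [← hinj.ncard_image, himg, Set.ncard_univ, Nat.card_zmod]
  · intro r₁ r₂ hr₁ hr₂
    have htop : Subgroup.closure {X, Y} = ⊤ := by
      have := Subgroup.closure_closure_coe_preimage (k := {(⟨x, hxK⟩ : pencilSubgroup p), ⟨y, hyK⟩})
      convert this using 2
      ext g
      simp [X, Y, Subtype.ext_iff]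
    -- Superdiagonal entry 1 reads off s and entry 0 reads off t, so they serve as σ and τ.
    refine mem_ramificationSizes_of_pow_eq_one hp hp5 htop (hpow1 hx (by simp))
      (hpow1 hy (by simp)) (hpow1 hXY (by simp)) ((superdiagHom p 1 (by omega)).comp H.subtype)
      ((superdiagHom p 0 (by omega)).comp H.subtype) ?_ ?_ ?_ ?_ hr₁ hr₂
    · exact superdiagHom_apply (A := ⟨x, hxK⟩) (by omega) hx
    · exact superdiagHom_apply (A := ⟨y, hyK⟩) (by omega) hy
    · exact superdiagHom_apply (A := ⟨x, hxK⟩) (by omega) hx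
    · exact superdiagHom_apply (A := ⟨y, hyK⟩) (by omega) hy
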